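/- Let $G$ be a locally compact Hausdorff group with unit $e$. Fell bundles over $G$ (also called $C^*$-algebraic bundles) are continuous and need not be saturated. For a bilinear operation and sets $S,T$, write $S\cdot T$ for the closed linear span of all products $s\cdot t$ with $s\in S$, $t\in T$. An action by adjointable maps of a Fell bundle $\mathcal A=\{A_t\}_{t\in G}$ on a Fell bundle $\mathcal B=\{B_t\}_{t\in G}$ is a map $\mathcal A\times\mathcal B\to\mathcal B$, $(a,b)\mapsto a\cdot b$, such that 1. $a\cdot b\in B_{st}$ for all $s,t\in G$, $a\in A_s$, $b\in B_t$; 2. for all $s,t\in G$ and $b\in B_t$, the map $A_s\to B_{st}$, $a\mapsto a\cdot b$, is linear; 3. $a\cdot(c\cdot b)=(ac)\cdot b$ for all $a,c\in\mathcal A$, $b\in\mathcal B$; 4. $(a\cdot b)^*d=b^*(a^*\cdot d)$ for all $a\in\mathcal A$, $b,d\in\mathcal B$; 5. for every $b\in B_e$ the map $\mathcal A\to\mathcal B$, $a\mapsto a\cdot b$, is continuous. The action is nondegenerate if $(A_tA_{t^{-1}})\cdot B_e=B_tB_{t^{-1}}$ for all $t\in G$, all products of sets being closed linear spans. **Proposition.**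 Let $\mathcal A$, $\mathcal B$ and $\mathcal C$ be Fell bundles over $G$, and let $\mathcal A\times\mathcal B\to\mathcal B$, $(a,b)\mapsto a\cdot b$, and $\mathcal B\times\mathcal C\to\mathcal C$, $(b,c)\mapsto b\diamond c$, be nondegenerate actions by adjointable maps. Then there exists a unique action by adjointable maps $\mathcal A\times\mathcal C\to\mathcal C$, $(a,c)\mapsto a\star c$, such that $$a\star(b\diamond c)=(a\cdot b)\diamond c\qquad\text{for all }(a,b,c)\in\mathcal A\times\mathcal B\times\mathcal C.$$ Moreover, $\star$ is nondegenerate. -/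

import Mathlib

open Topology Filter

universe u v v₁ v₂ v₃

/-- The fibre over `x` of a map `p : E → X`. It is a structure rather than a subtype, so that it
carries the norm of a Banach bundle and no topology inherited from `E`. -/
@[ext]
structure BundleFiber {E : Type v} {X : Type u} (p : E → X) (x : X) where
  val : E
  proj_val : p val = x

/-- A (continuous) Banach bundle over `X`: a Hausdorff total space with a continuous open
surjection onto `X` whose fibres are complex Banach spaces, such that the norm, the fibrewise
addition and each scalar multiplication are continuous on the total space, and such that
`bᵢ → 0ₓ` whenever `‖bᵢ‖ → 0` and `proj bᵢ → x`. -/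
structure BanachBundle (X : Type u) [TopologicalSpace X] where
  Total : Type v
  [topologicalSpace : TopologicalSpace Total]
  [t2Space : T2Space Total]
  proj : Total → X
  continuous_proj : Continuous proj
  isOpenMap_proj : IsOpenMap proj
  surjective_proj : Function.Surjective proj
  [normedAddCommGroup : ∀ x : X, NormedAddCommGroup (BundleFiber proj x)]
  [normedSpace : ∀ x : X, NormedSpace ℂ (BundleFiber proj x)]
  [completeSpace : ∀ x : X, CompleteSpace (BundleFiber proj x)]
  continuous_norm :
    Continuous fun b : Total => ‖(⟨b, rfl⟩ : BundleFiber proj (proj b))‖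
  continuous_add :
    Continuous fun p : {p : Total × Total // proj p.1 = proj p.2} =>
      ((⟨p.1.1, p.2⟩ : BundleFiber proj (proj p.1.2)) + ⟨p.1.2, rfl⟩).val
  continuous_const_smul : ∀ c : ℂ,
    Continuous fun b : Total => (c • (⟨b, rfl⟩ : BundleFiber proj (proj b))).val
  le_nhds_zero : ∀ (x : X) (l : Filter Total),
    Tendsto (fun b : Total => ‖(⟨b, rfl⟩ : BundleFiber proj (proj b))‖) l (𝓝 0) →
    Tendsto proj l (𝓝 x) → l ≤ 𝓝 (0 : BundleFiber proj x).val

attribute [instance] BanachBundle.topologicalSpace BanachBundle.t2Space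
  BanachBundle.normedAddCommGroup BanachBundle.normedSpace BanachBundle.completeSpace

/-- The fibre over `x`, a complex Banach space. -/
abbrev BanachBundle.Fiber {X : Type u} [TopologicalSpace X] (B : BanachBundle.{u, v} X) (x : X) :
    Type v :=
  BundleFiber B.proj x

/-- The norm of an element of the total space, taken in the fibre of that element. -/
def BanachBundle.norm {X : Type u} [TopologicalSpace X] (B : BanachBundle.{u, v} X)
    (b : B.Total) : ℝ :=
  ‖(⟨b, rfl⟩ : B.Fiber (B.proj b))‖

/-- A Fell bundle (C*-algebraic bundle) over the topological group `G`, not necessarily saturated: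
a Banach bundle whose total space is a topological semigroup with continuous involution, where
`B_s B_t ⊆ B_{st}` bilinearly, `(B_t)* ⊆ B_{t⁻¹}` conjugate-linearly, `‖bc‖ ≤ ‖b‖‖c‖`, `‖b*‖ = ‖b‖`,
`‖b*b‖ = ‖b‖²`, and `b*b` is a positive element of the C*-algebra `B_e`. -/
structure FellBundle (G : Type u) [Group G] [TopologicalSpace G] extends
    BanachBundle.{u, v} G where
  [semigroup : Semigroup Total]
  [starMul : StarMul Total]
  [continuousMul : ContinuousMul Total]
  [continuousStar : ContinuousStar Total]
  proj_mul : ∀ a b : Total, proj (a * b) = proj a * proj b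
  proj_star : ∀ a : Total, proj (star a) = (proj a)⁻¹
  isLinearMap_mul_left : ∀ (s t : G) (b : BundleFiber proj t),
    IsLinearMap ℂ fun a : BundleFiber proj s =>
      (⟨a.val * b.val, by rw [proj_mul, a.proj_val, b.proj_val]⟩ : BundleFiber proj (s * t))
  isLinearMap_mul_right : ∀ (s t : G) (a : BundleFiber proj s),
    IsLinearMap ℂ fun b : BundleFiber proj t =>
      (⟨a.val * b.val, by rw [proj_mul, a.proj_val, b.proj_val]⟩ : BundleFiber proj (s * t))
  star_add : ∀ (t : G) (a b : BundleFiber proj t),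
    (⟨star (a + b).val, by rw [proj_star, (a + b).proj_val]⟩ : BundleFiber proj t⁻¹) =
      ⟨star a.val, by rw [proj_star, a.proj_val]⟩ + ⟨star b.val, by rw [proj_star, b.proj_val]⟩
  star_smul : ∀ (t : G) (c : ℂ) (a : BundleFiber proj t),
    (⟨star (c • a).val, by rw [proj_star, (c • a).proj_val]⟩ : BundleFiber proj t⁻¹) =
      star c • ⟨star a.val, by rw [proj_star, a.proj_val]⟩
  norm_mul_le : ∀ a b : Total,
    toBanachBundle.norm (a * b) ≤ toBanachBundle.norm a * toBanachBundle.norm b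
  norm_star : ∀ a : Total, toBanachBundle.norm (star a) = toBanachBundle.norm a
  norm_star_mul_self : ∀ a : Total, toBanachBundle.norm (star a * a) = toBanachBundle.norm a ^ 2
  -- The positive elements of the C*-algebra over `1` are those of the form `c* c`.
  star_mul_self_nonneg : ∀ a : Total,
    ∃ c : BundleFiber proj (1 : G), star a * a = star c.val * c.val

attribute [instance] FellBundle.semigroup FellBundle.starMul FellBundle.continuousMul
  FellBundle.continuousStar

/-- `S · T` for a binary operation `f` with values in a topological vector space: the closed linear
span of the set of all `f a b` with `a ∈ S` and `b ∈ T`. -/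
def closedSpanMul {U : Type*} {V : Type*} {W : Type*} [NormedAddCommGroup W] [NormedSpace ℂ W]
    (f : U → V → W) (S : Set U) (T : Set V) : Submodule ℂ W :=
  (Submodule.span ℂ (Set.image2 f S T)).topologicalClosure

/-- The closed linear span `B_t B_{t⁻¹}`, a subspace of `B_e`. -/
def FellBundle.fiberIdeal {G : Type u} [Group G] [TopologicalSpace G] (B : FellBundle.{u, v} G)
    (t : G) : Submodule ℂ (B.Fiber 1) :=
  closedSpanMul (fun (a : B.Fiber t) (b : B.Fiber t⁻¹) =>
    (⟨a.val * b.val, by rw [B.proj_mul, a.proj_val, b.proj_val, mul_inv_cancel]⟩ : B.Fiber 1))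
    Set.univ Set.univ

/-- An action of the Fell bundle `A` on the Fell bundle `B` by adjointable maps. -/
@[ext]
structure AdjointableAction {G : Type u} [Group G] [TopologicalSpace G]
    (A : FellBundle.{u, v₁} G) (B : FellBundle.{u, v₂} G) where
  act : A.Total → B.Total → B.Total
  proj_act : ∀ (a : A.Total) (b : B.Total), B.proj (act a b) = A.proj a * B.proj b
  isLinearMap_act : ∀ (s t : G) (b : B.Fiber t),
    IsLinearMap ℂ fun a : A.Fiber s =>
      (⟨act a.val b.val, by rw [proj_act, a.proj_val, b.proj_val]⟩ : B.Fiber (s * t))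
  act_act : ∀ (a c : A.Total) (b : B.Total), act a (act c b) = act (a * c) b
  star_act_mul : ∀ (a : A.Total) (b d : B.Total), star (act a b) * d = star b * act (star a) d
  continuous_act : ∀ b : B.Fiber 1, Continuous fun a : A.Total => act a b.val

/-- The action is nondegenerate: `(A_t A_{t⁻¹}) · B_e = B_t B_{t⁻¹}` for all `t`, where all products
denote closed linear spans. -/
def AdjointableAction.Nondegenerate {G : Type u} [Group G] [TopologicalSpace G]
    {A : FellBundle.{u, v₁} G} {B : FellBundle.{u, v₂} G} (M : AdjointableAction A B) : Prop :=
  ∀ t : G,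
    closedSpanMul (fun (a : A.Fiber 1) (b : B.Fiber 1) =>
      (⟨M.act a.val b.val, by rw [M.proj_act, a.proj_val, b.proj_val, mul_one]⟩ : B.Fiber 1))
      (A.fiberIdeal t : Set (A.Fiber 1)) Set.univ = B.fiberIdeal t

/-! The product `a ⋆ c` is the limit of `(a · u) ⋄ c` as `u` runs through a contractive approximate
unit of `B_e`. On `b ⋄ c` the expression equals `(a · (u b)) ⋄ c`, which tends to `(a · b) ⋄ c`.
Such elements with `b ∈ B_e` span a dense subspace of every fibre of `C`
(`Nondegenerate.induction`), so the limit exists everywhere once the approximants are bounded by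
`‖a‖ ‖c‖`. Linearity passes to the limit; the other algebraic identities and uniqueness need
checking only on elements `b ⋄ c`.

The bound rests on automatic contractivity, `‖a · b‖ ≤ ‖a‖ ‖b‖`, which is not an axiom. It comes
from the adjoint relation and the C*-identity, starting from boundedness for `b ∈ B_e`, which the
continuity axiom provides (`norm_fiberActₗ_one_le`).

Continuity of `a ↦ a ⋆ c` for `c ∈ C_e` is clear on products and survives limits in `c`, by
`tendsto_of_approx` and the norm bound.

Fibre maps carry an equation `s * t = r`, so that group identities in the index require no transport
between fibres. -/

/-! ### Convergence in the total space of a Banach bundle. -/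

namespace BanachBundle

variable {X : Type u} [TopologicalSpace X] (B : BanachBundle.{u, v} X)

theorem norm_val {x : X} (b : B.Fiber x) : B.norm b.val = ‖b‖ := by
  obtain ⟨b, rfl⟩ := b
  rfl

theorem tendsto_norm {ι : Type*} {l : Filter ι} {x : ι → X} {f : ∀ i, B.Fiber (x i)} {y : X}
    {b : B.Fiber y} (hf : Tendsto (fun i => (f i).val) l (𝓝 b.val)) :
    Tendsto (fun i => ‖f i‖) l (𝓝 ‖b‖) := by
  have h := (B.continuous_norm.tendsto b.val).comp hf
  change Tendsto (fun i => B.norm (f i).val) l (𝓝 (B.norm b.val)) at h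
  simpa only [norm_val] using h

theorem tendsto_zero {ι : Type*} {l : Filter ι} {x : ι → X} {f : ∀ i, B.Fiber (x i)} {y : X}
    (hf : Tendsto (fun i => ‖f i‖) l (𝓝 0)) (hx : Tendsto x l (𝓝 y)) :
    Tendsto (fun i => (f i).val) l (𝓝 (0 : B.Fiber y).val) := by
  refine B.le_nhds_zero y _ ?_ ?_
  · change Tendsto B.norm _ _
    rw [tendsto_map'_iff]
    exact hf.congr fun i => (B.norm_val (f i)).symm
  · rw [tendsto_map'_iff]
    exact hx.congr fun i => (f i).proj_val.symm

theorem tendsto_add {ι : Type*} {l : Filter ι} {x : ι → X} {f g : ∀ i, B.Fiber (x i)} {y : X}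
    {b d : B.Fiber y} (hf : Tendsto (fun i => (f i).val) l (𝓝 b.val))
    (hg : Tendsto (fun i => (g i).val) l (𝓝 d.val)) :
    Tendsto (fun i => (f i + g i).val) l (𝓝 (b + d).val) := by
  have add_val : ∀ {z : X} (p q : B.Fiber z),
      ((⟨p.val, p.proj_val.trans q.proj_val.symm⟩ : B.Fiber (B.proj q.val)) + ⟨q.val, rfl⟩).val =
        (p + q).val := by
    rintro z p ⟨q, rfl⟩
    rfl
  have h : Tendsto (fun i => (⟨((f i).val, (g i).val),
      (f i).proj_val.trans (g i).proj_val.symm⟩ : {p : B.Total × B.Total // B.proj p.1 = B.proj p.2}))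
      l (𝓝 ⟨(b.val, d.val), b.proj_val.trans d.proj_val.symm⟩) :=
    tendsto_subtype_rng.2 (hf.prodMk_nhds hg)
  have h' := (B.continuous_add.tendsto _).comp h
  simp only [Function.comp_def, add_val] at h'
  exact h'

theorem tendsto_const_smul {ι : Type*} {l : Filter ι} {x : ι → X} {f : ∀ i, B.Fiber (x i)} {y : X}
    {b : B.Fiber y} (c : ℂ) (hf : Tendsto (fun i => (f i).val) l (𝓝 b.val)) :
    Tendsto (fun i => (c • f i).val) l (𝓝 (c • b).val) := by
  have smul_val : ∀ {z : X} (p : B.Fiber z),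
      (c • (⟨p.val, rfl⟩ : B.Fiber (B.proj p.val))).val = (c • p).val := by
    rintro z ⟨p, rfl⟩
    rfl
  have h' := ((B.continuous_const_smul c).tendsto _).comp hf
  simp only [Function.comp_def, smul_val] at h'
  exact h'

theorem tendsto_sub {ι : Type*} {l : Filter ι} {x : ι → X} {f g : ∀ i, B.Fiber (x i)} {y : X}
    {b d : B.Fiber y} (hf : Tendsto (fun i => (f i).val) l (𝓝 b.val))
    (hg : Tendsto (fun i => (g i).val) l (𝓝 d.val)) :
    Tendsto (fun i => (f i - g i).val) l (𝓝 (b - d).val) := by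
  simpa only [neg_one_smul, ← sub_eq_add_neg] using
    B.tendsto_add hf (B.tendsto_const_smul (-1) hg)

/-- The norm topology of a fibre is the one induced by the total space. -/
theorem tendsto_val_iff {ι : Type*} {l : Filter ι} {x : X} {f : ι → B.Fiber x} {b : B.Fiber x} :
    Tendsto (fun i => (f i).val) l (𝓝 b.val) ↔ Tendsto f l (𝓝 b) := by
  have hconst : Tendsto (fun _ : ι => b.val) l (𝓝 b.val) := tendsto_const_nhds
  constructor
  · intro h
    have h' := B.tendsto_norm (B.tendsto_sub h hconst)
    rw [sub_self, norm_zero] at h'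
    exact tendsto_iff_norm_sub_tendsto_zero.2 h'
  · intro h
    have h' := B.tendsto_add (B.tendsto_zero (tendsto_iff_norm_sub_tendsto_zero.1 h)
      (tendsto_const_nhds (x := x))) hconst
    simpa only [sub_add_cancel, zero_add] using h'

theorem continuous_val (x : X) : Continuous fun b : B.Fiber x => b.val :=
  continuous_iff_continuousAt.2 fun _ => B.tendsto_val_iff.2 tendsto_id

/-- A family which is locally uniformly approximable by convergent families converges. -/
theorem tendsto_of_approx {ι : Type*} {l : Filter ι} {x : ι → X} {f : ∀ i, B.Fiber (x i)} {y : X}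
    {b : B.Fiber y} (hx : Tendsto x l (𝓝 y))
    (h : ∀ ε > 0, ∃ (g : ∀ i, B.Fiber (x i)) (d : B.Fiber y),
      Tendsto (fun i => (g i).val) l (𝓝 d.val) ∧ ‖b - d‖ < ε ∧ ∀ᶠ i in l, ‖f i - g i‖ < ε) :
    Tendsto (fun i => (f i).val) l (𝓝 b.val) := by
  -- Convergence is tested against points `c` over `x i` tending to `b`. No section through `b` is
  -- chosen: `L` is the filter of pairs `(i, c)`, and openness of the projection (`hL`) ensures that
  -- a limit along `L` is a limit along `l`.
  let P := {p : ι × B.Total // B.proj p.2 = x p.1}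
  let L : Filter P := comap Subtype.val (l ×ˢ 𝓝 b.val)
  have hL : l ≤ map (fun p : P => p.1.1) L := by
    intro s hs
    obtain ⟨t, ht, hts⟩ := mem_comap.1 (mem_map.1 hs)
    obtain ⟨U, hU, V, hV, hUV⟩ := mem_prod_iff.1 ht
    have hV' : B.proj '' V ∈ 𝓝 y := by
      have := B.isOpenMap_proj.image_mem_nhds hV
      rwa [b.proj_val] at this
    filter_upwards [hU, hx hV'] with i hi hi'
    obtain ⟨c, hc, hci⟩ := hi'
    exact hts (a := (⟨(i, c), hci⟩ : P)) (hUV ⟨hi, hc⟩)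
  have hfst : Tendsto (fun p : P => p.1.1) L l :=
    tendsto_fst.comp tendsto_comap
  have hsnd : Tendsto (fun p : P => p.1.2) L (𝓝 b.val) :=
    tendsto_snd.comp tendsto_comap
  let c : ∀ p : P, B.Fiber (x p.1.1) := fun p => ⟨p.1.2, p.2⟩
  have hc : Tendsto (fun p => (c p).val) L (𝓝 b.val) := hsnd
  have hfc : Tendsto (fun p : P => ‖f p.1.1 - c p‖) L (𝓝 0) := by
    refine tendsto_order.2 ⟨fun r hr => Eventually.of_forall fun p => hr.trans_le (norm_nonneg _),
      fun ε hε => ?_⟩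
    obtain ⟨g, d, hg, hd, hfg⟩ := h (ε / 2) (half_pos hε)
    have h1 := B.tendsto_norm (B.tendsto_sub (hg.comp hfst) hc)
    have h2 : ∀ᶠ p in L, ‖g p.1.1 - c p‖ < ε / 2 :=
      h1.eventually_lt_const (by rwa [norm_sub_rev])
    filter_upwards [h2, hfst.eventually hfg] with p hp hp'
    have := norm_sub_le_norm_sub_add_norm_sub (f p.1.1) (g p.1.1) (c p)
    linarith
  have h3 := B.tendsto_add (B.tendsto_zero hfc (hx.comp hfst)) hc
  simp only [sub_add_cancel, zero_add] at h3
  exact (tendsto_map'_iff.2 h3).mono_left hL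

end BanachBundle

/-! ### Fibres of a Fell bundle and approximate units. -/

namespace FellBundle

variable {G : Type u} [Group G] [TopologicalSpace G] (B : FellBundle.{u, v} G)

/-- The multiplication `B_s × B_t → B_r` for `r = s t`. -/
noncomputable def fiberMul {s t r : G} (h : s * t = r) :
    B.Fiber s →L[ℂ] B.Fiber t →L[ℂ] B.Fiber r :=
  LinearMap.mkContinuous₂
    (LinearMap.mk₂ ℂ
      (fun a b => ⟨a.val * b.val, by rw [B.proj_mul, a.proj_val, b.proj_val, h]⟩)
      (by subst h; exact fun a a' b => (B.isLinearMap_mul_left s t b).map_add a a')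
      (by subst h; exact fun c a b => (B.isLinearMap_mul_left s t b).map_smul c a)
      (by subst h; exact fun a b b' => (B.isLinearMap_mul_right s t a).map_add b b')
      (by subst h; exact fun c a b => (B.isLinearMap_mul_right s t a).map_smul c b))
    1 fun a b => by
      have := B.norm_mul_le a.val b.val
      rw [B.norm_val, B.norm_val] at this
      rw [one_mul]
      refine le_trans (le_of_eq ?_) this
      rw [← B.norm_val]
      rfl

@[simp]
theorem val_fiberMul {s t r : G} (h : s * t = r) (a : B.Fiber s) (b : B.Fiber t) :
    (B.fiberMul h a b).val = a.val * b.val :=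
  rfl

theorem norm_fiberMul_le {s t r : G} (h : s * t = r) (a : B.Fiber s) (b : B.Fiber t) :
    ‖B.fiberMul h a b‖ ≤ ‖a‖ * ‖b‖ := by
  rw [← B.norm_val, ← B.norm_val, ← B.norm_val]
  exact B.norm_mul_le _ _

/-- The involution `B_t → B_r` for `r = t⁻¹`. -/
noncomputable def fiberStar {t r : G} (h : t⁻¹ = r) : B.Fiber t →ₗᵢ⋆[ℂ] B.Fiber r where
  toFun a := ⟨star a.val, by rw [B.proj_star, a.proj_val, h]⟩
  map_add' := by subst h; exact B.star_add t
  map_smul' := by subst h; exact B.star_smul t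
  norm_map' a := by
    rw [← B.norm_val, ← B.norm_val]
    exact B.norm_star _

@[simp]
theorem val_fiberStar {t r : G} (h : t⁻¹ = r) (a : B.Fiber t) :
    (B.fiberStar h a).val = star a.val :=
  rfl

theorem norm_fiberStar_mul_self {t r : G} (h : t⁻¹ = r) (h' : r * t = 1) (a : B.Fiber t) :
    ‖B.fiberMul h' (B.fiberStar h a) a‖ = ‖a‖ ^ 2 := by
  rw [← B.norm_val, ← B.norm_val]
  exact B.norm_star_mul_self _

theorem norm_mul_fiberStar_self {t r : G} (h : t⁻¹ = r) (h' : t * r = 1) (a : B.Fiber t) :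
    ‖B.fiberMul h' a (B.fiberStar h a)‖ = ‖a‖ ^ 2 := by
  have := B.norm_star_mul_self (star a.val)
  rw [star_star, B.norm_star] at this
  rw [← B.norm_val, ← B.norm_val]
  exact this

/-- An element of a fibre is determined by its products `x* d`. -/
theorem ext_star_mul {t : G} {x y : B.Fiber t}
    (h : ∀ d : B.Fiber t, star x.val * d.val = star y.val * d.val) : x = y := by
  have h1 : B.fiberMul (inv_mul_cancel t) (B.fiberStar rfl (x - y)) (x - y) = 0 := by
    rw [map_sub (B.fiberStar rfl), ContinuousLinearMap.map_sub₂, sub_eq_zero]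
    exact BundleFiber.ext (h (x - y))
  have h2 := B.norm_fiberStar_mul_self rfl (inv_mul_cancel t) (x - y)
  rw [h1, norm_zero] at h2
  exact sub_eq_zero.1 (norm_eq_zero.1 (pow_eq_zero_iff two_ne_zero |>.1 h2.symm))

/-- The C*-algebra structure of the fibre over the unit. -/
noncomputable abbrev unitFiberCStarAlgebra : NonUnitalCStarAlgebra (B.Fiber 1) where
  toNormedSpace := B.normedSpace 1
  __ := B.normedAddCommGroup 1
  mul a b := B.fiberMul (mul_one 1) a b
  left_distrib a b c := map_add _ _ _
  right_distrib a b c := B.fiberMul (mul_one 1) |>.map_add₂ _ _ _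
  zero_mul a := B.fiberMul (mul_one 1) |>.map_zero₂ _
  mul_zero a := map_zero _
  mul_assoc a b c := BundleFiber.ext (mul_assoc _ _ _)
  norm_mul_le := B.norm_fiberMul_le (mul_one 1)
  star a := B.fiberStar inv_one a
  star_involutive a := BundleFiber.ext (star_star a.val)
  star_mul a b := BundleFiber.ext (star_mul a.val b.val)
  star_add := map_add _
  complete := (B.completeSpace 1).complete
  norm_mul_self_le a := by
    have := B.norm_fiberStar_mul_self inv_one (mul_one 1) a
    rw [← sq]
    exact this.ge
  smul_assoc c a b := B.fiberMul (mul_one 1) |>.map_smul₂ c a b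
  smul_comm c a b := (map_smul (B.fiberMul (mul_one 1) a) c b).symm
  star_smul c a := (B.fiberStar inv_one).map_smulₛₗ c a

/-- The fibre over the unit contains an approximate unit acting on all fibres. -/
theorem exists_approximateUnit : ∃ l : Filter (B.Fiber 1), l.NeBot ∧ (∀ᶠ u in l, ‖u‖ ≤ 1) ∧
    ∀ (t : G) (b : B.Fiber t), Tendsto (fun u => B.fiberMul (one_mul t) u b) l (𝓝 b) := by
  obtain ⟨l, hne, hl1, hl⟩ : ∃ l : Filter (B.Fiber 1), l.NeBot ∧ (∀ᶠ u in l, ‖u‖ ≤ 1) ∧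
      ∀ x, Tendsto (fun u => B.fiberMul (one_mul 1) u x) l (𝓝 x) := by
    let := B.unitFiberCStarAlgebra
    let := CStarAlgebra.spectralOrder (B.Fiber 1)
    let := CStarAlgebra.spectralOrderedRing (B.Fiber 1)
    have h := CStarAlgebra.increasingApproximateUnit (B.Fiber 1)
    exact ⟨_, h.neBot, h.eventually_norm, fun x => h.tendsto_mul_right x⟩
  refine ⟨l, hne, hl1, fun t b => ?_⟩
  -- With `x = b b*` and `z = u b - b`, one has `z z* = (u x - x) u* - (u x - x)`. This reduces an
  -- arbitrary fibre to convergence in the unit fibre, and `‖u‖ ≤ 1` gives the constant 2.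
  let x : B.Fiber 1 := B.fiberMul (mul_inv_cancel t) b (B.fiberStar rfl b)
  have key : ∀ u : B.Fiber 1, ‖u‖ ≤ 1 →
      ‖B.fiberMul (one_mul t) u b - b‖ ^ 2 ≤ 2 * ‖B.fiberMul (one_mul 1) u x - x‖ := by
    intro u hu
    set z := B.fiberMul (one_mul t) u b - b with hz
    have e : B.fiberMul (mul_inv_cancel t) z (B.fiberStar rfl z) =
        B.fiberMul (mul_one 1) (B.fiberMul (one_mul 1) u x - x) (B.fiberStar inv_one u) -
          (B.fiberMul (one_mul 1) u x - x) := by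
      have e1 : B.fiberMul (mul_inv_cancel t) z (B.fiberStar rfl b) =
          B.fiberMul (one_mul 1) u x - x := by
        rw [hz, ContinuousLinearMap.map_sub₂]
        congr 1
        exact BundleFiber.ext (mul_assoc _ _ _)
      rw [← e1, hz, map_sub (B.fiberStar rfl), map_sub (B.fiberMul _ _), ← hz]
      congr 1
      refine BundleFiber.ext ?_
      simp [star_mul, mul_assoc]
    rw [← B.norm_mul_fiberStar_self rfl (mul_inv_cancel t), e]
    refine (norm_sub_le _ _).trans ?_
    have h1 := B.norm_fiberMul_le (mul_one 1) (B.fiberMul (one_mul 1) u x - x)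
      (B.fiberStar inv_one u)
    rw [LinearIsometry.norm_map] at h1
    have h2 := mul_le_of_le_one_right (norm_nonneg (B.fiberMul (one_mul 1) u x - x)) hu
    linarith
  rw [tendsto_iff_norm_sub_tendsto_zero]
  have h0 : Tendsto (fun u => 2 * ‖B.fiberMul (one_mul 1) u x - x‖) l (𝓝 0) := by
    simpa using (tendsto_iff_norm_sub_tendsto_zero.1 (hl x)).const_mul 2
  have h1 := squeeze_zero' (Eventually.of_forall fun u => sq_nonneg _) (hl1.mono key) h0
  have h2 := h1.sqrt
  simpa only [Real.sqrt_sq (norm_nonneg _), Real.sqrt_zero] using h2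

theorem fiberMul_mem_fiberIdeal_one (a b : B.Fiber 1) :
    B.fiberMul (mul_one 1) a b ∈ B.fiberIdeal 1 :=
  Submodule.le_topologicalClosure _ (Submodule.subset_span
    ⟨a, trivial, ⟨b.val, b.proj_val.trans inv_one.symm⟩, trivial, rfl⟩)

/-- Every `x` is the limit of the products `u x` along an approximate unit. -/
theorem fiberIdeal_one : B.fiberIdeal 1 = ⊤ := by
  obtain ⟨l, _, -, hl⟩ := B.exists_approximateUnit
  refine eq_top_iff.2 fun x _ => ?_
  exact (Submodule.isClosed_topologicalClosure _).mem_of_tendsto (hl 1 x)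
    (Eventually.of_forall fun u => B.fiberMul_mem_fiberIdeal_one u x)

end FellBundle

/-! ### Actions are bilinear and contractive. -/

namespace AdjointableAction

variable {G : Type u} [Group G] [TopologicalSpace G] {A : FellBundle.{u, v₁} G}
  {B : FellBundle.{u, v₂} G} (M : AdjointableAction A B)

/-- The map `b ↦ a · b` from `B_t` to `B_r` for `a ∈ A_s` and `r = s t`. -/
def fiberActRightₗ {s t r : G} (h : s * t = r) (a : A.Fiber s) : B.Fiber t →ₗ[ℂ] B.Fiber r :=
  let f : B.Fiber t → B.Fiber r :=
    fun b => ⟨M.act a.val b.val, by rw [M.proj_act, a.proj_val, b.proj_val, h]⟩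
  -- Linearity in `b` is not an axiom. The adjoint relation moves `a` to the other factor, where the
  -- dependence on `b` is only through `b*`, and the products `x* d` determine `x`.
  have adj (b : B.Fiber t) (d : B.Fiber r) :
      B.fiberMul (inv_mul_cancel r) (B.fiberStar rfl (f b)) d =
        B.fiberMul (by rw [← h]; group) (B.fiberStar rfl b)
          (⟨M.act (star a.val) d.val, by rw [M.proj_act, A.proj_star, a.proj_val, d.proj_val]⟩ :
            B.Fiber (s⁻¹ * r)) :=
    BundleFiber.ext (M.star_act_mul a.val b.val d.val)
  have ext {x y : B.Fiber r} (hxy : ∀ d, B.fiberMul (inv_mul_cancel r) (B.fiberStar rfl x) d =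
      B.fiberMul (inv_mul_cancel r) (B.fiberStar rfl y) d) : x = y :=
    B.ext_star_mul fun d => congrArg BundleFiber.val (hxy d)
  { toFun := f
    map_add' := fun b b' => ext fun d => by
      simp only [adj, map_add, add_apply]
    map_smul' := fun c b => ext fun d => by
      simp only [adj, map_smulₛₗ, smul_apply, RingHom.id_apply] }

/-- The action `A_s × B_t → B_r` for `r = s t`, as a bilinear map. -/
def fiberActₗ {s t r : G} (h : s * t = r) : A.Fiber s →ₗ[ℂ] B.Fiber t →ₗ[ℂ] B.Fiber r :=
  LinearMap.mk₂ ℂ (fun a b => M.fiberActRightₗ h a b)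
    (by subst h; exact fun a a' b => (M.isLinearMap_act s t b).map_add a a')
    (by subst h; exact fun c a b => (M.isLinearMap_act s t b).map_smul c a)
    (fun a => map_add (M.fiberActRightₗ h a))
    (fun c a => map_smul (M.fiberActRightₗ h a) c)

theorem val_fiberActₗ {s t r : G} (h : s * t = r) (a : A.Fiber s) (b : B.Fiber t) :
    (M.fiberActₗ h a b).val = M.act a.val b.val :=
  rfl

theorem star_fiberActₗ_mul {s t r s' t' r' p q : G} (h : s * t = r) (hr : r⁻¹ = r')
    (ht : t⁻¹ = t') (hs : s⁻¹ = s') {w : G} (hq : r' * p = q) (hw : s' * p = w) (hq' : t' * w = q)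
    (a : A.Fiber s) (b : B.Fiber t) (d : B.Fiber p) :
    B.fiberMul hq (B.fiberStar hr (M.fiberActₗ h a b)) d =
      B.fiberMul hq' (B.fiberStar ht b) (M.fiberActₗ hw (A.fiberStar hs a) d) :=
  BundleFiber.ext (M.star_act_mul a.val b.val d.val)

/-- For every `e`, both `(a · (b d))* e` and `((a · b) d)* e` equal `d* b* (a* · e)`. -/
theorem fiberActₗ_mul {s t r p w q : G} (h : s * t = r) (hw : t * p = w) (hq : s * w = q)
    (hq' : r * p = q) (a : A.Fiber s) (b : B.Fiber t) (d : B.Fiber p) :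
    M.fiberActₗ hq a (B.fiberMul hw b d) = B.fiberMul hq' (M.fiberActₗ h a b) d := by
  refine B.ext_star_mul fun e => ?_
  simp only [val_fiberActₗ, FellBundle.val_fiberMul, M.star_act_mul, star_mul, mul_assoc]

/-- By the C*-identity, `‖a · b‖² = ‖b* ((a* a) · b)‖`. Since `a* a` lies in the unit fibre,
estimates there control all fibres of `A`. -/
theorem norm_fiberActₗ_sq_le {s t r : G} (h : s * t = r) (a : A.Fiber s) (b : B.Fiber t) :
    ‖M.fiberActₗ h a b‖ ^ 2 ≤ ‖b‖ *
      ‖M.fiberActₗ (one_mul t) (A.fiberMul (inv_mul_cancel s) (A.fiberStar rfl a) a) b‖ := by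
  have hw : s⁻¹ * r = t := by rw [← h, inv_mul_cancel_left]
  rw [← B.norm_fiberStar_mul_self rfl (inv_mul_cancel r),
    M.star_fiberActₗ_mul h rfl rfl rfl (inv_mul_cancel r) hw (inv_mul_cancel t)]
  refine (B.norm_fiberMul_le _ _ _).trans (le_of_eq ?_)
  rw [LinearIsometry.norm_map]
  congr 2
  exact BundleFiber.ext (M.act_act _ _ _)

theorem norm_fiberActₗ_le_of_one {t : G} {b : B.Fiber t} {K : ℝ}
    (hK : ∀ a : A.Fiber 1, ‖M.fiberActₗ (one_mul t) a b‖ ≤ K * ‖a‖) {s r : G} (h : s * t = r)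
    (a : A.Fiber s) : ‖M.fiberActₗ h a b‖ ^ 2 ≤ ‖b‖ * (K * ‖a‖ ^ 2) := by
  refine (M.norm_fiberActₗ_sq_le h a b).trans ?_
  refine mul_le_mul_of_nonneg_left ((hK _).trans_eq ?_) (norm_nonneg b)
  rw [A.norm_fiberStar_mul_self]

/-- Any bound `K` improves itself: for `T a = a · b` the squared estimate gives `‖T‖² ≤ ‖b‖ ‖T‖`,
hence `‖T‖ ≤ ‖b‖`. -/
theorem norm_fiberActₗ_le_of_bounded {t : G} {b : B.Fiber t} {K : ℝ}
    (hK : ∀ a : A.Fiber 1, ‖M.fiberActₗ (one_mul t) a b‖ ≤ K * ‖a‖) (a : A.Fiber 1) :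
    ‖M.fiberActₗ (one_mul t) a b‖ ≤ ‖b‖ * ‖a‖ := by
  let T : A.Fiber 1 →L[ℂ] B.Fiber t := ((M.fiberActₗ (one_mul t)).flip b).mkContinuous K hK
  have hT : ‖T‖ ≤ √(‖b‖ * ‖T‖) := by
    refine T.opNorm_le_bound (Real.sqrt_nonneg _) fun x => ?_
    refine abs_le_of_sq_le_sq' ?_ (by positivity) |>.2
    rw [mul_pow, Real.sq_sqrt (by positivity), mul_assoc]
    exact M.norm_fiberActₗ_le_of_one T.le_opNorm (one_mul t) x
  have hT' : ‖T‖ ≤ ‖b‖ := by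
    rcases (norm_nonneg T).eq_or_lt with h0 | h0
    · exact h0 ▸ norm_nonneg b
    · have := (Real.le_sqrt (norm_nonneg T) (by positivity)).1 hT
      rw [sq] at this
      exact le_of_mul_le_mul_right this h0
  exact (T.le_opNorm a).trans (mul_le_mul_of_nonneg_right hT' (norm_nonneg a))

/-- Boundedness in `a` is known first for `y ∈ B_e`, then for `y b`, where the self-improving bound
has a constant independent of `y`. Continuity of `b ↦ a · b` is not yet available, so the limit `u b
→ b` is taken in `(a · b)* (u b) = b* (a* · (u b))`, whose left side is continuous in the last
factor. -/
theorem norm_fiberActₗ_one_le {t : G} (a : A.Fiber 1) (b : B.Fiber t) :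
    ‖M.fiberActₗ (one_mul t) a b‖ ≤ ‖b‖ * ‖a‖ := by
  have bdd1 (y : B.Fiber 1) : ∃ K, ∀ a : A.Fiber 1, ‖M.fiberActₗ (one_mul 1) a y‖ ≤ K * ‖a‖ := by
    let T : A.Fiber 1 →L[ℂ] B.Fiber 1 :=
      ⟨(M.fiberActₗ (one_mul 1)).flip y, continuous_iff_continuousAt.2 fun x =>
        B.tendsto_val_iff.1 (((M.continuous_act y).comp (A.continuous_val 1)).tendsto x)⟩
    exact ⟨‖T‖, T.le_opNorm⟩
  have bdd (y : B.Fiber 1) (a : A.Fiber 1) :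
      ‖M.fiberActₗ (one_mul t) a (B.fiberMul (one_mul t) y b)‖ ≤
        ‖B.fiberMul (one_mul t) y b‖ * ‖a‖ := by
    obtain ⟨K, hK⟩ := bdd1 y
    refine M.norm_fiberActₗ_le_of_bounded (K := K * ‖b‖) (fun a => ?_) a
    rw [M.fiberActₗ_mul (one_mul 1) (one_mul t) (one_mul t) (one_mul t), mul_right_comm]
    exact (B.norm_fiberMul_le _ _ _).trans (mul_le_mul_of_nonneg_right (hK a) (norm_nonneg b))
  obtain ⟨l, _, -, hl⟩ := B.exists_approximateUnit
  have main (a : A.Fiber 1) :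
      ‖B.fiberMul (inv_mul_cancel t) (B.fiberStar rfl (M.fiberActₗ (one_mul t) a b)) b‖ ≤
        ‖b‖ * (‖b‖ * ‖a‖) := by
    have h1 := (((B.fiberMul (inv_mul_cancel t)
      (B.fiberStar rfl (M.fiberActₗ (one_mul t) a b))).continuous.tendsto b).comp (hl t b)).norm
    refine le_of_tendsto_of_tendsto h1 (((hl t b).norm.mul_const ‖a‖).const_mul ‖b‖)
      (Eventually.of_forall fun u => ?_)
    simp only [Function.comp_apply]
    rw [M.star_fiberActₗ_mul (one_mul t) rfl rfl inv_one (inv_mul_cancel t) (one_mul t)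
      (inv_mul_cancel t)]
    refine (B.norm_fiberMul_le _ _ _).trans ?_
    rw [LinearIsometry.norm_map]
    refine mul_le_mul_of_nonneg_left ((bdd u _).trans_eq ?_) (norm_nonneg b)
    rw [LinearIsometry.norm_map]
  -- For `a* a` in place of `a`, the product in `main` is `((a* a) · b)* b`, which equals `(a · b)*
  -- (a · b)`.
  have h2 := main (A.fiberMul (mul_one 1) (A.fiberStar inv_one a) a)
  rw [A.norm_fiberStar_mul_self] at h2
  refine abs_le_of_sq_le_sq' ?_ (by positivity) |>.2
  rw [← B.norm_fiberStar_mul_self rfl (inv_mul_cancel t),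
    M.star_fiberActₗ_mul (one_mul t) rfl rfl inv_one (inv_mul_cancel t) (one_mul t)
      (inv_mul_cancel t)]
  rw [M.star_fiberActₗ_mul (one_mul t) rfl rfl inv_one (inv_mul_cancel t) (one_mul t)
      (inv_mul_cancel t)] at h2
  refine le_trans (le_of_eq (congrArg norm ?_)) (h2.trans_eq (by ring))
  congr 1
  refine BundleFiber.ext ?_
  simp [val_fiberActₗ, star_mul, M.act_act]

/-- The action `A_s × B_t → B_r` for `r = s t`, as a contractive bilinear map. -/
noncomputable def fiberAct {s t r : G} (h : s * t = r) :
    A.Fiber s →L[ℂ] B.Fiber t →L[ℂ] B.Fiber r :=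
  (M.fiberActₗ h).mkContinuous₂ 1 fun a b => by
    rw [one_mul]
    refine abs_le_of_sq_le_sq' ?_ (by positivity) |>.2
    refine (M.norm_fiberActₗ_le_of_one (fun a => M.norm_fiberActₗ_one_le a b) h a).trans_eq ?_
    ring

@[simp]
theorem val_fiberAct {s t r : G} (h : s * t = r) (a : A.Fiber s) (b : B.Fiber t) :
    (M.fiberAct h a b).val = M.act a.val b.val :=
  rfl

theorem norm_fiberAct_le {s t r : G} (h : s * t = r) (a : A.Fiber s) (b : B.Fiber t) :
    ‖M.fiberAct h a b‖ ≤ ‖a‖ * ‖b‖ := by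
  have := (M.fiberAct h).le_of_opNorm₂_le_of_le
    (LinearMap.mkContinuous₂_norm_le _ zero_le_one _) le_rfl le_rfl (x := a) (y := b)
  rwa [one_mul] at this

theorem act_mul (a : A.Total) (b d : B.Total) : M.act a (b * d) = M.act a b * d := by
  have := M.fiberActₗ_mul rfl rfl (mul_assoc _ _ _).symm rfl (⟨a, rfl⟩ : A.Fiber (A.proj a))
    (⟨b, rfl⟩ : B.Fiber (B.proj b)) (⟨d, rfl⟩ : B.Fiber (B.proj d))
  exact congrArg BundleFiber.val this

end AdjointableAction

/-! ### Closed linear spans of products. -/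

section closedSpanMul

variable {U V W : Type*} [NormedAddCommGroup W] [NormedSpace ℂ W] {f : U → V → W} {S : Set U}
  {T : Set V}

theorem mem_closedSpanMul {a : U} {b : V} (ha : a ∈ S) (hb : b ∈ T) :
    f a b ∈ closedSpanMul f S T :=
  Submodule.le_topologicalClosure _ (Submodule.subset_span ⟨a, ha, b, hb, rfl⟩)

theorem closedSpanMul_le {N : Submodule ℂ W} (hN : IsClosed (N : Set W))
    (h : ∀ a ∈ S, ∀ b ∈ T, f a b ∈ N) : closedSpanMul f S T ≤ N :=
  Submodule.topologicalClosure_minimal _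
    (Submodule.span_le.2 (by rintro _ ⟨a, ha, b, hb, rfl⟩; exact h a ha b hb)) hN

theorem isClosed_closedSpanMul : IsClosed (closedSpanMul f S T : Set W) :=
  Submodule.isClosed_topologicalClosure _

end closedSpanMul

/-! ### A fixed approximate unit. -/

namespace FellBundle

variable {G : Type u} [Group G] [TopologicalSpace G] (B : FellBundle.{u, v} G)

/-- A contractive approximate unit in the fibre over the unit. -/
noncomputable def approximateUnit : Filter (B.Fiber 1) :=
  B.exists_approximateUnit.choose

instance neBot_approximateUnit : B.approximateUnit.NeBot :=
  B.exists_approximateUnit.choose_spec.1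

theorem eventually_norm_le_one : ∀ᶠ u in B.approximateUnit, ‖u‖ ≤ 1 :=
  B.exists_approximateUnit.choose_spec.2.1

theorem tendsto_approximateUnit_mul {t : G} (b : B.Fiber t) :
    Tendsto (fun u => B.fiberMul (one_mul t) u b) B.approximateUnit (𝓝 b) :=
  B.exists_approximateUnit.choose_spec.2.2 t b

end FellBundle

/-! ### Density, uniqueness and nondegeneracy of the composition. -/

namespace AdjointableAction

variable {G : Type u} [Group G] [TopologicalSpace G] {A : FellBundle.{u, v₁} G}
  {B : FellBundle.{u, v₂} G} {C : FellBundle.{u, v₃} G}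

/-- The elements `b · c` with `b` in the unit fibre span a dense subspace of every fibre. -/
theorem Nondegenerate.induction {D : AdjointableAction B C} (hD : D.Nondegenerate) {t : G}
    {P : C.Fiber t → Prop} (closed : IsClosed {c | P c}) (add : ∀ c c', P c → P c' → P (c + c'))
    (act : ∀ (b : B.Fiber 1) (c : C.Fiber t), P (D.fiberAct (one_mul t) b c)) (c : C.Fiber t) :
    P c := by
  have h1 : c ∈ closedSpanMul (fun (b : B.Fiber 1) (c : C.Fiber t) => D.fiberAct (one_mul t) b c)
      Set.univ Set.univ := by
    refine isClosed_closedSpanMul.mem_of_tendsto (C.tendsto_approximateUnit_mul c)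
      (Eventually.of_forall fun u => ?_)
    -- Nondegeneracy at the unit places `u` in the closed span of the `b · c'`, and `(b · c') c = b
    -- · (c' c)` carries this to the fibre over `t`.
    have hu : u ∈ C.fiberIdeal 1 := C.fiberIdeal_one ▸ Submodule.mem_top
    rw [← hD 1] at hu
    let N := closedSpanMul (fun (b : B.Fiber 1) (c : C.Fiber t) => D.fiberAct (one_mul t) b c)
      Set.univ Set.univ
    let T := (C.fiberMul (one_mul t)).flip c
    refine closedSpanMul_le (N := N.comap T.toLinearMap)
      (isClosed_closedSpanMul.preimage T.continuous) ?_ hu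
    intro b _ c' _
    have : C.fiberMul (one_mul t) (D.fiberAct (one_mul 1) b c') c =
        D.fiberAct (one_mul t) b (C.fiberMul (one_mul t) c' c) :=
      BundleFiber.ext (D.act_mul _ _ _).symm
    change C.fiberMul (one_mul t) (D.fiberAct (one_mul 1) b c') c ∈ N
    rw [this]
    exact mem_closedSpanMul trivial trivial
  refine closure_minimal (fun x hx => ?_) closed h1
  -- `P` is not assumed stable under scalars; on generators a scalar is absorbed into the second
  -- factor.
  have h2 : ∀ k : ℂ, P (k • x) := by
    induction hx using Submodule.span_induction with
    | mem x hx =>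
      obtain ⟨b, -, c, -, rfl⟩ := hx
      exact fun k => map_smul (D.fiberAct (one_mul t) b) k c ▸ act _ _
    | zero => exact fun k => by simpa using act 0 0
    | add x y _ _ hx hy => exact fun k => smul_add k x y ▸ add _ _ (hx k) (hy k)
    | smul r x _ hx => exact fun k => smul_smul k r x ▸ hx _
  simpa using h2 1

/-- The relation `a ⋆ (b · c) = (a · b) · c`. -/
def IsComp (M : AdjointableAction A B) (D : AdjointableAction B C) (S : AdjointableAction A C) :
    Prop :=
  ∀ a b c, S.act a (D.act b c) = D.act (M.act a b) c

variable {M : AdjointableAction A B} {D : AdjointableAction B C}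

theorem IsComp.unique (hD : D.Nondegenerate) {S S' : AdjointableAction A C} (hS : IsComp M D S)
    (hS' : IsComp M D S') : S' = S := by
  refine AdjointableAction.ext (funext₂ fun a c => ?_)
  suffices h : ∀ c' : C.Fiber (C.proj c),
      S'.fiberAct rfl (⟨a, rfl⟩ : A.Fiber (A.proj a)) c' = S.fiberAct rfl ⟨a, rfl⟩ c' from
    congrArg BundleFiber.val (h ⟨c, rfl⟩)
  refine hD.induction (isClosed_eq (map_continuous _) (map_continuous _))
    (fun c₁ c₂ h₁ h₂ => by rw [map_add, map_add, h₁, h₂])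
    (fun b c' => BundleFiber.ext ((hS' _ _ _).trans (hS _ _ _).symm))

/-- Both closed spans are compared with `(B_t B_{t⁻¹}) ⋄ C_e`: the relation `a ⋆ (b ⋄ c) = (a · b) ⋄
c` translates between them, since `(A_t A_{t⁻¹}) · B_e = B_t B_{t⁻¹}` and the `b ⋄ c` are total in
`C_e`. -/
theorem IsComp.nondegenerate (hM : M.Nondegenerate) (hD : D.Nondegenerate)
    {S : AdjointableAction A C} (hS : IsComp M D S) : S.Nondegenerate := by
  intro t
  rw [← hD t]
  apply le_antisymm
  · refine closedSpanMul_le isClosed_closedSpanMul fun a ha c hc => ?_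
    change S.fiberAct (mul_one 1) a c ∈ _
    clear hc
    induction c using hD.induction with
    | closed => exact isClosed_closedSpanMul.preimage (S.fiberAct (mul_one 1) a).continuous
    | add c c' h h' => rw [map_add]; exact add_mem h h'
    | act b c =>
      have hb : M.fiberAct (mul_one 1) a b ∈ B.fiberIdeal t := by
        rw [← hM t]
        exact mem_closedSpanMul (f := fun a b => M.fiberAct (mul_one 1) a b) ha trivial
      have h : S.fiberAct (mul_one 1) a (D.fiberAct (one_mul 1) b c) =
          D.fiberAct (mul_one 1) (M.fiberAct (mul_one 1) a b) c := BundleFiber.ext (hS _ _ _)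
      rw [h]
      exact mem_closedSpanMul (f := fun b c => D.fiberAct (mul_one 1) b c) hb trivial
  · refine closedSpanMul_le isClosed_closedSpanMul fun b hb c _ => ?_
    let T := (D.fiberAct (mul_one 1)).flip c
    let N := closedSpanMul (fun a c => S.fiberAct (mul_one 1) a c)
      (A.fiberIdeal t : Set (A.Fiber 1)) Set.univ
    change b ∈ B.fiberIdeal t at hb
    rw [← hM t] at hb
    refine closedSpanMul_le (N := N.comap T.toLinearMap)
      (isClosed_closedSpanMul.preimage T.continuous) ?_ hb
    intro a ha b _
    change D.fiberAct (mul_one 1) (M.fiberAct (mul_one 1) a b) c ∈ N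
    have h : S.fiberAct (mul_one 1) a (D.fiberAct (one_mul 1) b c) =
        D.fiberAct (mul_one 1) (M.fiberAct (mul_one 1) a b) c := BundleFiber.ext (hS _ _ _)
    rw [← h]
    exact mem_closedSpanMul ha trivial

/-! ### Construction of the composition. -/

variable (M)

theorem norm_fiberAct_fiberAct_le (D : AdjointableAction B C) {s t r : G} (h : s * t = r)
    (a : A.Fiber s) (c : C.Fiber t) {u : B.Fiber 1} (hu : ‖u‖ ≤ 1) :
    ‖D.fiberAct h (M.fiberAct (mul_one s) a u) c‖ ≤ ‖a‖ * ‖c‖ := by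
  refine (D.norm_fiberAct_le _ _ _).trans (mul_le_mul_of_nonneg_right ?_ (norm_nonneg c))
  exact (M.norm_fiberAct_le _ _ _).trans (mul_le_of_le_one_right (norm_nonneg a) hu)

theorem tendsto_fiberAct_fiberAct (D : AdjointableAction B C) {s t r p q w : G} (h : s * t = r)
    (hp : p * q = t) (hw : s * p = w) (hr : w * q = r) (a : A.Fiber s) (b : B.Fiber p)
    (c : C.Fiber q) :
    Tendsto (fun u => D.fiberAct h (M.fiberAct (mul_one s) a u) (D.fiberAct hp b c))
      B.approximateUnit (𝓝 (D.fiberAct hr (M.fiberAct hw a b) c)) := by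
  have h1 : ∀ u, D.fiberAct h (M.fiberAct (mul_one s) a u) (D.fiberAct hp b c) =
      (D.fiberAct hr).flip c (M.fiberAct hw a (B.fiberMul (one_mul p) u b)) := fun u =>
    BundleFiber.ext (by simp [D.act_act, M.act_mul])
  simp only [h1]
  exact (((D.fiberAct hr).flip c).continuous.tendsto _).comp
    (((M.fiberAct hw a).continuous.tendsto b).comp (B.tendsto_approximateUnit_mul b))

/-- The limit is explicit on elements `b ⋄ c`. The bound uniform in `u` makes the set of good `c`
closed, by a Cauchy argument in a complete fibre. -/
theorem exists_tendsto_fiberAct_fiberAct (hD : D.Nondegenerate) {s t r : G} (h : s * t = r)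
    (a : A.Fiber s) (c : C.Fiber t) :
    ∃ x, Tendsto (fun u => D.fiberAct h (M.fiberAct (mul_one s) a u) c) B.approximateUnit
      (𝓝 x) := by
  induction c using hD.induction with
  | closed =>
    refine isClosed_of_closure_subset fun c hc => ?_
    rw [Set.mem_ofPred_eq, ← cauchy_map_iff_exists_tendsto, Metric.cauchy_iff]
    refine ⟨inferInstance, fun ε hε => ?_⟩
    -- Replacing `c` by `c'` costs less than `ε / 4`, and so does approaching `x`, so the values end
    -- up in a ball of radius `ε / 2`. The `+ 1` covers `a = 0`.
    obtain ⟨c', ⟨x, hx⟩, hc'⟩ := Metric.mem_closure_iff.1 hc (ε / 4 / (‖a‖ + 1)) (by positivity)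
    refine ⟨Metric.ball x (ε / 2), ?_, fun y hy z hz => ?_⟩
    · rw [mem_map]
      filter_upwards [Metric.tendsto_nhds.1 hx (ε / 4) (by positivity),
        B.eventually_norm_le_one] with u hu hu1
      have h1 := M.norm_fiberAct_fiberAct_le D h a (c - c') hu1
      rw [map_sub, ← dist_eq_norm, ← dist_eq_norm] at h1
      rw [lt_div_iff₀ (by positivity)] at hc'
      have h2 := dist_triangle (D.fiberAct h (M.fiberAct (mul_one s) a u) c)
        (D.fiberAct h (M.fiberAct (mul_one s) a u) c') x
      have h3 := dist_nonneg (x := c) (y := c')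
      change dist _ _ < _
      linarith
    · have := dist_triangle_right y z x
      rw [Metric.mem_ball] at hy hz
      linarith
  | add c c' h₁ h₂ =>
    obtain ⟨x, hx⟩ := h₁
    obtain ⟨y, hy⟩ := h₂
    exact ⟨x + y, by simpa only [map_add] using hx.add hy⟩
  | act b c => exact ⟨_, M.tendsto_fiberAct_fiberAct D h (one_mul t) (mul_one s) h a b c⟩

theorem tendsto_limUnder_fiberAct_fiberAct (hD : D.Nondegenerate) {s t r : G} (h : s * t = r)
    (a : A.Fiber s) (c : C.Fiber t) :
    Tendsto (fun u => D.fiberAct h (M.fiberAct (mul_one s) a u) c) B.approximateUnit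
      (𝓝 (limUnder B.approximateUnit fun u => D.fiberAct h (M.fiberAct (mul_one s) a u) c)) :=
  tendsto_nhds_limUnder (M.exists_tendsto_fiberAct_fiberAct hD h a c)

/-- The bilinear map `A_s × C_t → C_r`, for `r = s t`, sending `(a, c)` to the limit of
`(a · u) · c` along an approximate unit `u`. -/
noncomputable def compFiber (hD : D.Nondegenerate) {s t r : G} (h : s * t = r) :
    A.Fiber s →L[ℂ] C.Fiber t →L[ℂ] C.Fiber r :=
  LinearMap.mkContinuous₂
    (LinearMap.mk₂ ℂ
      (fun a c => limUnder B.approximateUnit fun u => D.fiberAct h (M.fiberAct (mul_one s) a u) c)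
      (fun a a' c => Tendsto.limUnder_eq <| by
        simpa only [map_add, add_apply] using
          (M.tendsto_limUnder_fiberAct_fiberAct hD h a c).add
            (M.tendsto_limUnder_fiberAct_fiberAct hD h a' c))
      (fun k a c => Tendsto.limUnder_eq <| by
        simpa only [map_smul, smul_apply] using
          (M.tendsto_limUnder_fiberAct_fiberAct hD h a c).const_smul k)
      (fun a c c' => Tendsto.limUnder_eq <| by
        simpa only [map_add] using
          (M.tendsto_limUnder_fiberAct_fiberAct hD h a c).add
            (M.tendsto_limUnder_fiberAct_fiberAct hD h a c'))
      (fun k a c => Tendsto.limUnder_eq <| by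
        simpa only [map_smul] using
          (M.tendsto_limUnder_fiberAct_fiberAct hD h a c).const_smul k))
    1 fun a c => by
      rw [one_mul]
      exact le_of_tendsto (M.tendsto_limUnder_fiberAct_fiberAct hD h a c).norm
        (B.eventually_norm_le_one.mono fun u hu => M.norm_fiberAct_fiberAct_le D h a c hu)

theorem norm_compFiber_le (hD : D.Nondegenerate) {s t r : G} (h : s * t = r) (a : A.Fiber s)
    (c : C.Fiber t) : ‖M.compFiber hD h a c‖ ≤ ‖a‖ * ‖c‖ := by
  have := (M.compFiber hD h).le_of_opNorm₂_le_of_le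
    (LinearMap.mkContinuous₂_norm_le _ zero_le_one _) le_rfl le_rfl (x := a) (y := c)
  rwa [one_mul] at this

theorem compFiber_fiberAct (hD : D.Nondegenerate) {s t r p q w : G} (h : s * t = r)
    (hp : p * q = t) (hw : s * p = w) (hr : w * q = r) (a : A.Fiber s) (b : B.Fiber p)
    (c : C.Fiber q) :
    M.compFiber hD h a (D.fiberAct hp b c) = D.fiberAct hr (M.fiberAct hw a b) c :=
  (M.tendsto_fiberAct_fiberAct D h hp hw hr a b c).limUnder_eq

theorem compFiber_compFiber (hD : D.Nondegenerate) {s s' w t r q : G} (h : s' * t = r)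
    (hq : s * r = q) (hw : s * s' = w) (hq' : w * t = q) (a : A.Fiber s) (a' : A.Fiber s')
    (c : C.Fiber t) :
    M.compFiber hD hq a (M.compFiber hD h a' c) = M.compFiber hD hq' (A.fiberMul hw a a') c := by
  induction c using hD.induction with
  | closed =>
    exact isClosed_eq ((map_continuous _).comp (map_continuous _)) (map_continuous _)
  | add c c' h₁ h₂ => rw [map_add, map_add, map_add, h₁, h₂]
  | act b c =>
    rw [M.compFiber_fiberAct hD h (one_mul t) (mul_one s') h,
      M.compFiber_fiberAct hD hq h hw hq',
      M.compFiber_fiberAct hD hq' (one_mul t) (mul_one w) hq']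
    exact BundleFiber.ext (by simp [M.act_act])

/-- By density in both variables it suffices to take `b ⋄ c` and `b' ⋄ d`. The adjoint relations of
the two given actions then turn both sides into `c* ((b* (a* · b')) ⋄ d)`. -/
theorem fiberStar_compFiber_mul (hD : D.Nondegenerate) {s t r s' t' r' p q w : G} (h : s * t = r)
    (hr : r⁻¹ = r') (ht : t⁻¹ = t') (hs : s⁻¹ = s') (hq : r' * p = q) (hw : s' * p = w)
    (hq' : t' * w = q) (a : A.Fiber s) (c : C.Fiber t) (d : C.Fiber p) :
    C.fiberMul hq (C.fiberStar hr (M.compFiber hD h a c)) d =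
      C.fiberMul hq' (C.fiberStar ht c) (M.compFiber hD hw (A.fiberStar hs a) d) := by
  induction c using hD.induction with
  | closed =>
    exact isClosed_eq (((C.fiberMul hq).flip d).continuous.comp
      ((C.fiberStar hr).continuous.comp (map_continuous _)))
      (((C.fiberMul hq').flip _).continuous.comp (C.fiberStar ht).continuous)
  | add c c' h₁ h₂ =>
    rw [map_add, map_add, ContinuousLinearMap.map_add₂, h₁, h₂, map_add,
      ContinuousLinearMap.map_add₂]
  | act b c =>
    induction d using hD.induction with
    | closed =>
      exact isClosed_eq (map_continuous _) ((map_continuous _).comp (map_continuous _))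
    | add d d' h₁ h₂ => rw [map_add, map_add, map_add, h₁, h₂]
    | act b' d =>
      rw [M.compFiber_fiberAct hD h (one_mul t) (mul_one s) h,
        M.compFiber_fiberAct hD hw (one_mul p) (mul_one s') hw]
      refine BundleFiber.ext ?_
      simp only [FellBundle.val_fiberMul, FellBundle.val_fiberStar, val_fiberAct, D.star_act_mul,
        D.act_act, M.star_act_mul]

/-- The action `a ⋆ c` on the total spaces. -/
noncomputable def compAct (hD : D.Nondegenerate) (a : A.Total) (c : C.Total) : C.Total :=
  (M.compFiber hD rfl (⟨a, rfl⟩ : A.Fiber (A.proj a)) (⟨c, rfl⟩ : C.Fiber (C.proj c))).val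

theorem compAct_val (hD : D.Nondegenerate) {s t r : G} (h : s * t = r) (a : A.Fiber s)
    (c : C.Fiber t) : M.compAct hD a.val c.val = (M.compFiber hD h a c).val := by
  obtain ⟨a, rfl⟩ := a
  obtain ⟨c, rfl⟩ := c
  subst h
  rfl

/-- For `b ⋄ c` with both factors in unit fibres, the map `a ↦ (a · b) ⋄ c` is a composite of two
maps continuous by axiom. -/
theorem tendsto_compFiber (hD : D.Nondegenerate) (a₀ : A.Total) (c : C.Fiber 1) :
    Tendsto (fun a : A.Total => (M.compFiber hD (mul_one (A.proj a)) ⟨a, rfl⟩ c).val) (𝓝 a₀)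
      (𝓝 (M.compFiber hD (mul_one (A.proj a₀)) ⟨a₀, rfl⟩ c).val) := by
  induction c using hD.induction with
  | closed =>
    refine isClosed_of_closure_subset fun c hc => ?_
    refine C.tendsto_of_approx (A.continuous_proj.tendsto a₀) fun ε hε => ?_
    -- By continuity of the norm, `‖a‖ < n + 1` near `a₀`, so approximating `c` within `ε / (n + 1)`
    -- gives an error below `ε` uniformly there.
    let n := ‖(⟨a₀, rfl⟩ : A.Fiber (A.proj a₀))‖
    have hn : 0 < n + 1 := by positivity
    obtain ⟨c', hc', hcc'⟩ := Metric.mem_closure_iff.1 hc (ε / (n + 1)) (by positivity)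
    rw [lt_div_iff₀ hn, dist_eq_norm] at hcc'
    have key : ∀ a : A.Total, ‖(⟨a, rfl⟩ : A.Fiber (A.proj a))‖ < n + 1 →
        ‖M.compFiber hD (mul_one (A.proj a)) ⟨a, rfl⟩ c -
          M.compFiber hD (mul_one (A.proj a)) ⟨a, rfl⟩ c'‖ < ε := by
      intro a ha
      rw [← map_sub]
      refine (M.norm_compFiber_le hD _ _ _).trans_lt (lt_of_le_of_lt ?_ hcc')
      rw [mul_comm]
      exact mul_le_mul_of_nonneg_left ha.le (norm_nonneg _)
    exact ⟨_, _, hc', key a₀ (lt_add_one n),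
      ((A.continuous_norm.tendsto a₀).eventually_lt_const (lt_add_one n)).mono key⟩
  | add c c' h₁ h₂ => simpa only [map_add] using C.tendsto_add h₁ h₂
  | act b c =>
    simp only [M.compFiber_fiberAct hD (mul_one _) (one_mul 1) (mul_one _) (mul_one _),
      val_fiberAct]
    exact ((D.continuous_act c).comp (M.continuous_act b)).tendsto a₀

/-- The composition `⋆` of two actions, characterised by `a ⋆ (b · c) = (a · b) · c`. -/
noncomputable def comp (hD : D.Nondegenerate) : AdjointableAction A C where
  act := M.compAct hD
  proj_act _ _ := BundleFiber.proj_val _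
  isLinearMap_act s t c :=
    { map_add := fun a a' => BundleFiber.ext <| by
        simp only [M.compAct_val hD rfl, ContinuousLinearMap.map_add₂]
      map_smul := fun k a => BundleFiber.ext <| by
        simp only [M.compAct_val hD rfl, ContinuousLinearMap.map_smul₂] }
  act_act a a' c := by
    have h := M.compFiber_compFiber hD rfl rfl rfl (mul_assoc _ _ _)
      (⟨a, rfl⟩ : A.Fiber (A.proj a)) (⟨a', rfl⟩ : A.Fiber (A.proj a'))
      (⟨c, rfl⟩ : C.Fiber (C.proj c))
    simpa only [← M.compAct_val, FellBundle.val_fiberMul] using congrArg BundleFiber.val h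
  star_act_mul a c d := by
    have h := M.fiberStar_compFiber_mul hD rfl rfl rfl rfl rfl rfl (by group)
      (⟨a, rfl⟩ : A.Fiber (A.proj a)) (⟨c, rfl⟩ : C.Fiber (C.proj c))
      (⟨d, rfl⟩ : C.Fiber (C.proj d))
    simpa only [← M.compAct_val, FellBundle.val_fiberMul, FellBundle.val_fiberStar] using
      congrArg BundleFiber.val h
  continuous_act c := continuous_iff_continuousAt.2 fun a₀ => by
    have h := M.tendsto_compFiber hD a₀ c
    simp only [← M.compAct_val] at h
    exact h

theorem isComp_comp (hD : D.Nondegenerate) : IsComp M D (M.comp hD) := by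
  intro a b c
  have h := M.compFiber_fiberAct hD rfl rfl rfl (mul_assoc _ _ _)
    (⟨a, rfl⟩ : A.Fiber (A.proj a)) (⟨b, rfl⟩ : B.Fiber (B.proj b))
    (⟨c, rfl⟩ : C.Fiber (C.proj c))
  have h' := congrArg BundleFiber.val h
  simp only [← M.compAct_val, val_fiberAct] at h'
  exact h'

end AdjointableAction

theorem mainTheorem11 {G : Type u} [Group G] [TopologicalSpace G] [IsTopologicalGroup G]
    [LocallyCompactSpace G] [T2Space G]
    (A : FellBundle.{u, v₁} G) (B : FellBundle.{u, v₂} G) (C : FellBundle.{u, v₃} G)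
    (M : AdjointableAction A B) (hM : M.Nondegenerate)
    (D : AdjointableAction B C) (hD : D.Nondegenerate) :
    ∃ S : AdjointableAction A C,
      (∀ (a : A.Total) (b : B.Total) (c : C.Total), S.act a (D.act b c) = D.act (M.act a b) c) ∧
      S.Nondegenerate ∧
      ∀ S' : AdjointableAction A C,
        (∀ (a : A.Total) (b : B.Total) (c : C.Total),
          S'.act a (D.act b c) = D.act (M.act a b) c) → S' = S := by
  exact ⟨M.comp hD, M.isComp_comp hD, (M.isComp_comp hD).nondegenerate hM hD,
    fun _ hS' => (M.isComp_comp hD).unique hD hS'⟩
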